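/- Let $f:\mathbb R^n\to(-\infty,+\infty]$ and $g:\mathbb R^m\to(-\infty,+\infty]$ be proper closed convex functions, let $K\in\mathbb R^{m\times n}$, and let $g^*(y)=\sup_z\{\langle z,y\rangle-g(z)\}$ be the convex conjugate of $g$. Assume that $$\min_{x\in\mathbb R^n}\max_{y\in\mathbb R^m}\ \mathcal L(x,y)=f(x)+\langle Kx,y\rangle-g^*(y)$$ has a saddle point, i.e. a pair $(x^\star,y^\star)$ with $\mathcal L(x^\star,y)\le\mathcal L(x^\star,y^\star)\le\mathcal L(x,y^\star)$ for all $x,y$. For a symmetric matrix $M$ write $\|z\|_M^2=\langle z,Mz\rangle$. Let $\Sigma_f\in\mathbb R^{n\times n}$ be a symmetric positive semidefinite matrix such that $\langle\xi_1-\xi_2,x_1-x_2\rangle\ge\|x_1-x_2\|_{\Sigma_f}^2$ whenever $\xi_1\in\partial f(x_1)$ and $\xi_2\in\partial f(x_2)$, and let $M_1\in\mathbb R^{n\times n}$, $M_2\in\mathbb R^{m\times m}$ be symmetric matrices with $$M_1+\tfrac12\Sigma_f\succ0,\qquad M_2\succ0,\qquad \Big\|M_2^{-1/2}K\big(M_1+\tfrac12\Sigma_f\big)^{-1/2}\Big\|^2<\tfrac43$$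 (spectral norm). Define the KKT residual by $$\mathcal R(x,y)=\max\{\operatorname{dist}(0,\partial f(x)+K^{\mathsf T}y),\ \operatorname{dist}(0,\partial g^*(y)-Kx)\},$$ where the distance to the empty set is $+\infty$. Given $(x^0,y^0)\in\mathbb R^n\times\mathbb R^m$ and a tolerance $\epsilon$, the algorithm PrePDHG computes, in the iterations $k=0,1,2,\dots$, $$x^{k+1}=\operatorname*{argmin}_{x}\ f(x)+\langle Kx,y^k\rangle+\tfrac12\|x-x^k\|_{M_1}^2,\qquad y^{k+1}=\operatorname*{argmin}_{y}\ g^*(y)-\langle K(2x^{k+1}-x^k),y\rangle+\tfrac12\|y-y^k\|_{M_2}^2,$$ and stops at the end of the first iteration with $\mathcal R(x^{k+1},y^{k+1})\le\epsilon$. Then the recursion determines a unique sequence $\{(x^k,y^k)\}$ (every argmin exists and is unique), and, for every $\epsilon>0$, the algorithm stops after $O(1/\epsilon^2)$ iterations: there is a constant $C$, independent of $\epsilon$ (it may depend on $f,g,K,\Sigma_f,M_1,M_2,x^0,y^0$), such that for every $\epsilon>0$ the algorithm stops after some number $N\ge1$ of iterations with $N\le\max\{1,\,C/\epsilon^2\}$.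 -/

import Mathlib

noncomputable section

namespace PrePDHG

/-- The Euclidean space `ℝⁿ` with its standard inner product. -/
abbrev E (n : ℕ) : Type := EuclideanSpace ℝ (Fin n)

/-- A proper closed convex function `ℝⁿ → (-∞, +∞]`: it never takes the value `-∞`, it is finite
somewhere, it is lower semicontinuous and its epigraph is convex. -/
structure IsProperClosedConvex {n : ℕ} (f : E n → EReal) : Prop where
  ne_bot : ∀ x, f x ≠ ⊥
  exists_lt_top : ∃ x, f x < ⊤
  closed : LowerSemicontinuous f
  convex : Convex ℝ {p : E n × ℝ | f p.1 ≤ (p.2 : EReal)}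

/-- The convex conjugate `f^*(y) = sup_x {⟨x, y⟩ - f x}`. -/
def conjugate {n : ℕ} (f : E n → EReal) (y : E n) : EReal :=
  ⨆ x : E n, ((inner ℝ x y : ℝ) : EReal) - f x

/-- The subdifferential `∂f(x)`; it is empty at the points outside the effective domain. -/
def subdifferential {n : ℕ} (f : E n → EReal) (x : E n) : Set (E n) :=
  {ξ | f x < ⊤ ∧ ∀ z : E n, f x + ((inner ℝ ξ (z - x) : ℝ) : EReal) ≤ f z}

/-- The action of a real matrix on Euclidean vectors. -/
def app {m n : ℕ} (A : Matrix (Fin m) (Fin n) ℝ) (x : E n) : E m :=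
  Matrix.toEuclideanLin A x

/-- `‖z‖_M² = ⟨z, M z⟩`, for a symmetric, possibly indefinite, matrix `M`. -/
def quad {n : ℕ} (M : Matrix (Fin n) (Fin n) ℝ) (z : E n) : ℝ :=
  inner ℝ z (app M z)

/-- `S` is an admissible choice of `Σ_f`: it is positive semidefinite and the subdifferential of
`f` satisfies `⟨ξ₁ - ξ₂, x₁ - x₂⟩ ≥ ‖x₁ - x₂‖_S²`. -/
def IsMonotonicityMatrix {n : ℕ} (f : E n → EReal) (S : Matrix (Fin n) (Fin n) ℝ) : Prop :=
  S.PosSemidef ∧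
    ∀ x₁ x₂ ξ₁ ξ₂ : E n, ξ₁ ∈ subdifferential f x₁ → ξ₂ ∈ subdifferential f x₂ →
      quad S (x₁ - x₂) ≤ inner ℝ (ξ₁ - ξ₂) (x₁ - x₂)

/-- The Lagrangian `L(x, y) = f x + ⟨K x, y⟩ - g^* y`. -/
def lagrangian {m n : ℕ} (f : E n → EReal) (g : E m → EReal) (K : Matrix (Fin m) (Fin n) ℝ)
    (x : E n) (y : E m) : EReal :=
  f x + ((inner ℝ (app K x) y : ℝ) : EReal) - conjugate g y

/-- The min-max problem has a saddle point. -/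
def HasSaddlePoint {m n : ℕ} (f : E n → EReal) (g : E m → EReal)
    (K : Matrix (Fin m) (Fin n) ℝ) : Prop :=
  ∃ (x : E n) (y : E m), IsSaddlePointOn Set.univ Set.univ (lagrangian f g K) x y

/-- The KKT residual
`R(x, y) = max {dist(0, ∂f(x) + Kᵀ y), dist(0, ∂g^*(y) - K x)}`,
where the distance to the empty set is `+∞`. -/
def kktResidual {m n : ℕ} (f : E n → EReal) (g : E m → EReal) (K : Matrix (Fin m) (Fin n) ℝ)
    (x : E n) (y : E m) : ENNReal :=
  max (Metric.infEDist (0 : E n) ((fun ξ => ξ + app K.transpose y) '' subdifferential f x))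
    (Metric.infEDist (0 : E m) ((fun η => η - app K x) '' subdifferential (conjugate g) y))

section StepCondition

open scoped Matrix.Norms.L2Operator MatrixOrder

/-- `M^{-1/2}`, the positive semidefinite square root of `M⁻¹`, for `M` positive definite. -/
def invSqrt {n : ℕ} (M : Matrix (Fin n) (Fin n) ℝ) : Matrix (Fin n) (Fin n) ℝ :=
  CFC.sqrt M⁻¹

/-- The condition
`M₁ + Σ_f / 2 ≻ 0`, `M₂ ≻ 0`, `‖M₂^{-1/2} K (M₁ + Σ_f / 2)^{-1/2}‖² < 4 / 3`
on the symmetric matrices `M₁`, `M₂` (with the spectral norm). -/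
structure StepCondition {m n : ℕ} (K : Matrix (Fin m) (Fin n) ℝ) (S : Matrix (Fin n) (Fin n) ℝ)
    (M₁ : Matrix (Fin n) (Fin n) ℝ) (M₂ : Matrix (Fin m) (Fin m) ℝ) : Prop where
  symm₁ : M₁.IsSymm
  symm₂ : M₂.IsSymm
  posDef₁ : (M₁ + (1 / 2 : ℝ) • S).PosDef
  posDef₂ : M₂.PosDef
  norm_lt : ‖invSqrt M₂ * K * invSqrt (M₁ + (1 / 2 : ℝ) • S)‖ ^ 2 < 4 / 3

end StepCondition

/-- `z` is an infinite sequence `(xᵏ, yᵏ)` generated from `(x⁰, y⁰)` by the recursion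
`xᵏ⁺¹ = argmin_x f x + ⟨K x, yᵏ⟩ + ‖x - xᵏ‖_{M₁}² / 2`,
`yᵏ⁺¹ = argmin_y g^* y - ⟨K (2 xᵏ⁺¹ - xᵏ), y⟩ + ‖y - yᵏ‖_{M₂}² / 2`. -/
structure IsIterates {m n : ℕ} (f : E n → EReal) (g : E m → EReal) (K : Matrix (Fin m) (Fin n) ℝ)
    (M₁ : Matrix (Fin n) (Fin n) ℝ) (M₂ : Matrix (Fin m) (Fin m) ℝ) (x₀ : E n) (y₀ : E m)
    (z : ℕ → E n × E m) : Prop where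
  init : z 0 = (x₀, y₀)
  step_x : ∀ k, IsMinOn
    (fun x : E n => f x +
      ((inner ℝ (app K x) (z k).2 + (1 / 2) * quad M₁ (x - (z k).1) : ℝ) : EReal))
    Set.univ (z (k + 1)).1
  step_y : ∀ k, IsMinOn
    (fun y : E m => conjugate g y +
      ((-inner ℝ (app K ((2 : ℝ) • (z (k + 1)).1 - (z k).1)) y
        + (1 / 2) * quad M₂ (y - (z k).2) : ℝ) : EReal))
    Set.univ (z (k + 1)).2

/-- With tolerance `ε`, the algorithm that produces the iterates `z` and tests
`R(xᵏ⁺¹, yᵏ⁺¹) ≤ ε` at the end of each iteration breaks at the end of iteration number `N ≥ 1`,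
i.e. after exactly `N` iterations. -/
def StopsAfter {m n : ℕ} (f : E n → EReal) (g : E m → EReal) (K : Matrix (Fin m) (Fin n) ℝ)
    (z : ℕ → E n × E m) (ε : ℝ) (N : ℕ) : Prop :=
  IsLeast {k : ℕ | 1 ≤ k ∧ kktResidual f g K (z k).1 (z k).2 ≤ ENNReal.ofReal ε} N

end PrePDHG

end

namespace PrePDHG

open Filter Topology

/-! ### Matrices as operators and quadratic forms. -/

section LinearAlgebra

/-! Write P = M₁ + S/2, q(d) = ⟨Kd, M₂⁻¹Kd⟩, d_k = xᵏ⁺¹ - xᵏ, e_k = yᵏ⁺¹ - yᵏ. The spectral norm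
condition says q ≤ κ‖·‖_P² with κ < 4/3 (`StepCondition.exists_bound`).

The steps are well posed although M₁ may be indefinite: monotonicity of ∂f with matrix S makes f
grow at least like ‖·‖_S²/4 above its tangents (`IsMonotonicityMatrix.subgradient_le`). The proximal
objective then grows like ‖·‖_P²/2, so minimizers exist; they are unique because P is positive
definite.

The rate comes from a Lyapunov function Φ_k ≥ 0. Besides the distance to a KKT point, with the dual
error shifted by M₂⁻¹K d_k, it contains terms in d_k. Monotonicity of ∂f and ∂g* against the KKT
point gives the usual descent. This alone is too weak up to 4/3; monotonicity of ∂f between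
consecutive primal iterates supplies the missing control of ⟨K d_{k+1}, e_k⟩. The decrease Φ_k -
Φ_{k+1} dominates ‖d_{k+1}‖² + ‖s_k‖², where s_k = e_k - M₂⁻¹K d_k + M₂⁻¹K d_{k+1}/2
(`lyapunov_decrease`).

The optimality conditions bound the KKT residual by a multiple of ‖d_k‖ + ‖e_k‖, hence of ‖d_k‖ +
‖d_{k+1}‖ + ‖s_k‖. Squared residual bounds are therefore summable, and at most C/ε² of the tests can
fail. -/

lemma app_add {m n : ℕ} (A : Matrix (Fin m) (Fin n) ℝ) (x y : E n) :
    app A (x + y) = app A x + app A y := map_add _ x y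

lemma app_sub {m n : ℕ} (A : Matrix (Fin m) (Fin n) ℝ) (x y : E n) :
    app A (x - y) = app A x - app A y := map_sub _ x y

lemma app_neg {m n : ℕ} (A : Matrix (Fin m) (Fin n) ℝ) (x : E n) :
    app A (-x) = -app A x := map_neg _ x

lemma app_smul {m n : ℕ} (A : Matrix (Fin m) (Fin n) ℝ) (c : ℝ) (x : E n) :
    app A (c • x) = c • app A x := map_smul _ c x

lemma matrix_add_app {m n : ℕ} (A B : Matrix (Fin m) (Fin n) ℝ) (x : E n) :
    app (A + B) x = app A x + app B x := by
  simp [app]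

lemma matrix_smul_app {m n : ℕ} (c : ℝ) (A : Matrix (Fin m) (Fin n) ℝ) (x : E n) :
    app (c • A) x = c • app A x := by
  simp [app]

lemma matrix_mul_app {l m n : ℕ} (A : Matrix (Fin l) (Fin m) ℝ) (B : Matrix (Fin m) (Fin n) ℝ)
    (x : E n) : app (A * B) x = app A (app B x) := by
  ext i
  simp [app, Matrix.toLpLin_apply]

lemma one_app {n : ℕ} (x : E n) : app (1 : Matrix (Fin n) (Fin n) ℝ) x = x := by
  ext i
  simp [app]

lemma inner_app_left {m n : ℕ} (A : Matrix (Fin m) (Fin n) ℝ) (x : E n) (y : E m) :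
    inner ℝ (app A x) y = inner ℝ x (app A.transpose y) := by
  have h := LinearMap.adjoint_inner_right (Matrix.toEuclideanLin A) x y
  rw [← Matrix.toEuclideanLin_conjTranspose_eq_adjoint,
    Matrix.conjTranspose_eq_transpose_of_trivial] at h
  exact h.symm

lemma inner_app_symm {n : ℕ} {A : Matrix (Fin n) (Fin n) ℝ} (hA : A.IsSymm) (x y : E n) :
    inner ℝ (app A x) y = inner ℝ (app A y) x := by
  rw [inner_app_left, hA.eq, real_inner_comm]

lemma quad_eq {n : ℕ} (A : Matrix (Fin n) (Fin n) ℝ) (x : E n) :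
    quad A x = inner ℝ (app A x) x := real_inner_comm _ _

lemma quad_nonneg {n : ℕ} {A : Matrix (Fin n) (Fin n) ℝ} (hA : A.PosSemidef) (x : E n) :
    0 ≤ quad A x := by
  have h := hA.dotProduct_mulVec_nonneg x.ofLp
  simpa [quad, app, Matrix.toLpLin_apply, PiLp.inner_apply, dotProduct, mul_comm] using h

lemma quad_smul {n : ℕ} (A : Matrix (Fin n) (Fin n) ℝ) (c : ℝ) (x : E n) :
    quad A (c • x) = c ^ 2 * quad A x := by
  simp only [quad, app_smul, inner_smul_left, inner_smul_right]
  simp; ring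

lemma quad_neg {n : ℕ} (A : Matrix (Fin n) (Fin n) ℝ) (x : E n) :
    quad A (-x) = quad A x := by
  simp [quad, app_neg]

lemma quad_add_matrix {n : ℕ} (A B : Matrix (Fin n) (Fin n) ℝ) (x : E n) :
    quad (A + B) x = quad A x + quad B x := by
  simp only [quad, matrix_add_app, inner_add_right]

lemma quad_smul_matrix {n : ℕ} (c : ℝ) (A : Matrix (Fin n) (Fin n) ℝ) (x : E n) :
    quad (c • A) x = c * quad A x := by
  simp only [quad, matrix_smul_app, inner_smul_right]

lemma quad_add {n : ℕ} {A : Matrix (Fin n) (Fin n) ℝ} (hA : A.IsSymm) (x h : E n) :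
    quad A (x + h) = quad A x + 2 * inner ℝ (app A x) h + quad A h := by
  have := inner_app_symm hA x h
  simp only [quad_eq, app_add, inner_add_left, inner_add_right]
  linarith

lemma continuous_app {m n : ℕ} (A : Matrix (Fin m) (Fin n) ℝ) : Continuous (app A) :=
  LinearMap.continuous_of_finiteDimensional (Matrix.toEuclideanLin A)

lemma continuous_quad {n : ℕ} (A : Matrix (Fin n) (Fin n) ℝ) : Continuous (quad A) :=
  continuous_id.inner (continuous_app A)

open scoped Matrix.Norms.L2Operator MatrixOrder

lemma norm_app_le {m n : ℕ} (A : Matrix (Fin m) (Fin n) ℝ) (x : E n) :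
    ‖app A x‖ ≤ ‖A‖ * ‖x‖ := Matrix.l2_opNorm_mulVec A x

lemma invSqrt_symm {n : ℕ} (M : Matrix (Fin n) (Fin n) ℝ) : (invSqrt M).IsSymm := by
  have h : IsSelfAdjoint (CFC.sqrt M⁻¹) := (CFC.sqrt_nonneg M⁻¹).isSelfAdjoint
  have h2 : (CFC.sqrt M⁻¹).conjTranspose = CFC.sqrt M⁻¹ := h
  rwa [Matrix.conjTranspose_eq_transpose_of_trivial] at h2

lemma invSqrt_mul_self {n : ℕ} {M : Matrix (Fin n) (Fin n) ℝ} (hM : M.PosDef) :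
    invSqrt M * invSqrt M = M⁻¹ :=
  CFC.sqrt_mul_sqrt_self _ (Matrix.nonneg_iff_posSemidef.2 hM.inv.posSemidef)

lemma isSymm_of_posSemidef {n : ℕ} {M : Matrix (Fin n) (Fin n) ℝ} (hM : M.PosSemidef) :
    M.IsSymm := by
  have := hM.isHermitian
  rwa [Matrix.IsHermitian, Matrix.conjTranspose_eq_transpose_of_trivial] at this

lemma inv_app_app {n : ℕ} {M : Matrix (Fin n) (Fin n) ℝ} (hM : M.PosDef) (x : E n) :
    app M⁻¹ (app M x) = x := by
  rw [← matrix_mul_app, Matrix.nonsing_inv_mul _ ((Matrix.isUnit_iff_isUnit_det _).1 hM.isUnit),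
    one_app]

lemma app_inv_app {n : ℕ} {M : Matrix (Fin n) (Fin n) ℝ} (hM : M.PosDef) (x : E n) :
    app M (app M⁻¹ x) = x := by
  rw [← matrix_mul_app, Matrix.mul_nonsing_inv _ ((Matrix.isUnit_iff_isUnit_det _).1 hM.isUnit),
    one_app]

lemma exists_invSqrt_app_eq {n : ℕ} {M : Matrix (Fin n) (Fin n) ℝ} (hM : M.PosDef) (d : E n) :
    ∃ w, app (invSqrt M) w = d ∧ ‖w‖ ^ 2 = quad M d := by
  have key : ∀ z, app (invSqrt M) (app (invSqrt M) z) = app M⁻¹ z := fun z => by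
    rw [← matrix_mul_app, invSqrt_mul_self hM]
  -- The witness is M^{1/2} d, written as M^{-1/2} M d so that only one square root is needed.
  refine ⟨app (invSqrt M) (app M d), ?_, ?_⟩
  · rw [key, inv_app_app hM]
  · rw [← real_inner_self_eq_norm_sq, inner_app_left, (invSqrt_symm M).eq, key, inv_app_app hM,
      quad_eq]

lemma norm_invSqrt_app_sq {n : ℕ} {M : Matrix (Fin n) (Fin n) ℝ} (hM : M.PosDef) (d : E n) :
    ‖app (invSqrt M) d‖ ^ 2 = inner ℝ d (app M⁻¹ d) := by
  rw [← real_inner_self_eq_norm_sq, inner_app_left, (invSqrt_symm M).eq, ← matrix_mul_app,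
    invSqrt_mul_self hM]

lemma exists_quad_ge {n : ℕ} {M : Matrix (Fin n) (Fin n) ℝ} (hM : M.PosDef) :
    ∃ α : ℝ, 0 < α ∧ ∀ x, α * ‖x‖ ^ 2 ≤ quad M x := by
  have hp : 0 < ‖invSqrt M‖ ^ 2 + 1 := by positivity
  refine ⟨1 / (‖invSqrt M‖ ^ 2 + 1), by positivity, fun x => ?_⟩
  obtain ⟨w, rfl, hw⟩ := exists_invSqrt_app_eq hM x
  rw [← hw, div_mul_eq_mul_div, one_mul, div_le_iff₀ hp]
  have h := norm_app_le (invSqrt M) w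
  have h2 := pow_le_pow_left₀ (norm_nonneg _) h 2
  nlinarith [sq_nonneg ‖w‖]

/-- The step condition as an inequality between quadratic forms. -/
lemma StepCondition.exists_bound {m n : ℕ} {K : Matrix (Fin m) (Fin n) ℝ}
    {S M₁ : Matrix (Fin n) (Fin n) ℝ} {M₂ : Matrix (Fin m) (Fin m) ℝ}
    (h : StepCondition K S M₁ M₂) :
    ∃ κ : ℝ, κ < 4 / 3 ∧ ∀ d : E n,
      inner ℝ (app K d) (app M₂⁻¹ (app K d)) ≤ κ * quad (M₁ + (1 / 2 : ℝ) • S) d := by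
  refine ⟨_, h.norm_lt, fun d => ?_⟩
  obtain ⟨w, rfl, hw⟩ := exists_invSqrt_app_eq h.posDef₁ d
  rw [← hw, ← norm_invSqrt_app_sq h.posDef₂, ← mul_pow, ← matrix_mul_app, ← matrix_mul_app]
  exact pow_le_pow_left₀ (norm_nonneg _) (norm_app_le _ w) 2

end LinearAlgebra

/-! ### Closed convex functions, subgradients and proximal points. -/

section ConvexAnalysis

variable {n : ℕ} {F : E n → EReal}

lemma IsProperClosedConvex.exists_real (hF : IsProperClosedConvex F) {x : E n} (hx : F x < ⊤) :
    ∃ a : ℝ, F x = a :=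
  ⟨(F x).toReal, (EReal.coe_toReal hx.ne (hF.ne_bot x)).symm⟩

lemma IsProperClosedConvex.le_combination (hF : IsProperClosedConvex F) {x z : E n} {a b t : ℝ}
    (hx : F x ≤ a) (hz : F z ≤ b) (h0 : 0 ≤ t) (h1 : t ≤ 1) :
    F (x + t • (z - x)) ≤ ((a + t * (b - a) : ℝ) : EReal) := by
  have h := hF.convex (x := (x, a)) hx (y := (z, b)) hz (sub_nonneg.2 h1) h0 (by ring)
  have e : (1 - t) • (x, a) + t • (z, b) = (x + t • (z - x), a + t * (b - a)) := by
    ext1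
    · simp only [Prod.smul_mk, Prod.mk_add_mk]; module
    · simp only [Prod.smul_mk, Prod.mk_add_mk, smul_eq_mul]; ring
  rw [e] at h
  exact h

lemma isClosed_real_epigraph (hF : LowerSemicontinuous F) :
    IsClosed {p : E n × ℝ | F p.1 ≤ (p.2 : EReal)} :=
  hF.isClosed_epigraph.preimage
    (f := fun p : E n × ℝ => (p.1, (p.2 : EReal)))
    (continuous_fst.prodMk (continuous_coe_real_ereal.comp continuous_snd))

/-- Strictly separate the epigraph from a point one unit below the graph. The two points share their
first coordinate, so the separating functional has positive vertical slope and is the graph of an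
affine function. -/
lemma IsProperClosedConvex.exists_affine_minorant (hF : IsProperClosedConvex F) :
    ∃ (ξ : E n) (c : ℝ), ∀ z, ((inner ℝ ξ z + c : ℝ) : EReal) ≤ F z := by
  obtain ⟨x, hx⟩ := hF.exists_lt_top
  obtain ⟨a, ha⟩ := hF.exists_real hx
  have hmem : (x, a - 1) ∉ {p : E n × ℝ | F p.1 ≤ (p.2 : EReal)} := by
    simp only [Set.mem_ofPred_eq, ha, EReal.coe_le_coe_iff]
    linarith
  obtain ⟨φ, u, hu, hφ⟩ := geometric_hahn_banach_point_closed hF.convex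
    (isClosed_real_epigraph hF.closed) hmem
  set ℓ : E n →L[ℝ] ℝ := φ.comp (ContinuousLinearMap.inl ℝ (E n) ℝ) with hℓ
  set c : ℝ := φ (0, 1) with hc
  have hdec : ∀ z t, φ (z, t) = ℓ z + t * c := fun z t => by
    have : (z, t) = (z, 0) + t • ((0 : E n), (1 : ℝ)) := by simp
    rw [this, map_add, map_smul]
    simp [hℓ, hc]
  have hxa := hφ (x, a) ha.le
  rw [hdec] at hu hxa
  have hcpos : 0 < c := by linarith
  refine ⟨-(1 / c) • (InnerProductSpace.toDual ℝ (E n)).symm ℓ, u / c, fun z => ?_⟩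
  rcases eq_or_ne (F z) ⊤ with hz | hz
  · rw [hz]; exact le_top
  obtain ⟨b, hb⟩ := hF.exists_real (lt_top_iff_ne_top.2 hz)
  have h := hφ (z, b) hb.le
  rw [hdec] at h
  rw [hb, EReal.coe_le_coe_iff, inner_smul_left, InnerProductSpace.toDual_symm_apply]
  have : -(1 / c) * ℓ z + u / c = (u - ℓ z) / c := by field_simp; ring
  simp only [RCLike.conj_to_real]
  rw [this, div_le_iff₀ hcpos]
  linarith

/-- A supremum of affine functions is closed and convex. It is finite at the slope of any affine
minorant of g. -/
lemma isProperClosedConvex_conjugate {g : E n → EReal} (hg : IsProperClosedConvex g) :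
    IsProperClosedConvex (conjugate g) := by
  obtain ⟨x, hx⟩ := hg.exists_lt_top
  obtain ⟨a, ha⟩ := hg.exists_real hx
  obtain ⟨ξ, c, hξ⟩ := hg.exists_affine_minorant
  have hle : ∀ (y : E n) (t : ℝ), conjugate g y ≤ t ↔
      ∀ z (b : ℝ), g z = b → inner ℝ z y - b ≤ t := by
    intro y t
    rw [conjugate, iSup_le_iff]
    refine ⟨fun h z b hb => ?_, fun h z => ?_⟩
    · have := h z
      rw [hb] at this
      exact_mod_cast this
    · rcases eq_or_ne (g z) ⊤ with hz | hz
      · rw [hz, EReal.sub_top]; exact bot_le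
      obtain ⟨b, hb⟩ := hg.exists_real (lt_top_iff_ne_top.2 hz)
      rw [hb]
      exact_mod_cast h z b hb
  refine ⟨fun y h => ?_, ⟨ξ, ?_⟩, ?_, ?_⟩
  · have h1 : ((inner ℝ x y : ℝ) : EReal) - g x ≤ conjugate g y := le_iSup
      (fun x : E n => ((inner ℝ x y : ℝ) : EReal) - g x) x
    rw [h, ha, ← EReal.coe_sub] at h1
    exact EReal.coe_ne_bot _ (le_bot_iff.1 h1)
  · refine lt_of_le_of_lt ((hle ξ (-c)).2 fun z b hb => ?_) (EReal.coe_lt_top (-c))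
    have := hξ z
    rw [hb, EReal.coe_le_coe_iff, real_inner_comm] at this
    linarith
  · refine lowerSemicontinuous_iSup fun z => ?_
    rcases eq_or_ne (g z) ⊤ with hz | hz
    · simp only [hz, EReal.sub_top]; exact lowerSemicontinuous_const
    obtain ⟨b, hb⟩ := hg.exists_real (lt_top_iff_ne_top.2 hz)
    simp only [hb, ← EReal.coe_sub]
    exact (continuous_coe_real_ereal.comp
      ((continuous_const.inner continuous_id).sub continuous_const)).lowerSemicontinuous
  · rintro ⟨y, s⟩ hy ⟨y', s'⟩ hy' α β hα hβ hαβ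
    simp only [Set.mem_ofPred_eq, Prod.smul_mk, Prod.mk_add_mk, hle] at hy hy' ⊢
    intro z b hb
    have h1 := mul_le_mul_of_nonneg_left (hy z b hb) hα
    have h2 := mul_le_mul_of_nonneg_left (hy' z b hb) hβ
    rw [inner_add_right, inner_smul_right, inner_smul_right, smul_eq_mul, smul_eq_mul]
    have : b = α * b + β * b := by rw [← add_mul, hαβ, one_mul]
    linarith

/-- The objective `F z + ⟨b, z⟩ + ‖z - c‖_M² / 2` of a proximal step. -/
noncomputable def proxObjective (F : E n → EReal) (M : Matrix (Fin n) (Fin n) ℝ) (b c z : E n) :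
    EReal :=
  F z + ((inner ℝ b z + 1 / 2 * quad M (z - c) : ℝ) : EReal)

variable {M : Matrix (Fin n) (Fin n) ℝ} {b c : E n}

/-- Fermat's rule without a sum rule: compare x with x + t(z - x), use convexity of F, divide by t
and let t → 0. The quadratic part contributes O(t), so M need not be positive. -/
lemma mem_subdifferential_of_isMinOn (hF : IsProperClosedConvex F) (hM : M.IsSymm) {x : E n}
    (hx : IsMinOn (proxObjective F M b c) Set.univ x) :
    -b - app M (x - c) ∈ subdifferential F x := by
  have hmin : ∀ z, proxObjective F M b c x ≤ proxObjective F M b c z := fun z => hx (Set.mem_univ z)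
  have hxt : F x < ⊤ := by
    obtain ⟨w, hw⟩ := hF.exists_lt_top
    obtain ⟨r, hr⟩ := hF.exists_real hw
    rw [lt_top_iff_ne_top]
    intro htop
    have := hmin w
    rw [proxObjective, proxObjective, htop, hr, EReal.top_add_coe, ← EReal.coe_add,
      top_le_iff] at this
    exact EReal.coe_ne_top _ this
  refine ⟨hxt, fun z => ?_⟩
  obtain ⟨r, hr⟩ := hF.exists_real hxt
  rcases eq_or_ne (F z) ⊤ with hz | hz
  · rw [hz]; exact le_top
  obtain ⟨s, hs⟩ := hF.exists_real (lt_top_iff_ne_top.2 hz)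
  rw [hr, hs, ← EReal.coe_add, EReal.coe_le_coe_iff]
  set a := b + app M (x - c) with ha
  have hineq : ∀ t : ℝ, 0 < t → t ≤ 1 →
      0 ≤ s - r + inner ℝ a (z - x) + t * (1 / 2 * quad M (z - x)) := by
    intro t h0 h1
    have h := (hmin (x + t • (z - x))).trans
      (add_le_add_left (hF.le_combination hr.le hs.le h0.le h1) _)
    rw [proxObjective, hr, ← EReal.coe_add, ← EReal.coe_add, EReal.coe_le_coe_iff,
      add_sub_right_comm x, quad_add hM, quad_smul, inner_add_right, inner_smul_right,
      inner_smul_right] at h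
    have : 0 ≤ t * (s - r + inner ℝ a (z - x) + t * (1 / 2 * quad M (z - x))) := by
      rw [ha, inner_add_left]
      nlinarith
    exact nonneg_of_mul_nonneg_right this h0
  have hlim : Tendsto (fun t : ℝ => s - r + inner ℝ a (z - x) + t * (1 / 2 * quad M (z - x)))
      (𝓝[>] 0) (𝓝 (s - r + inner ℝ a (z - x) + 0 * (1 / 2 * quad M (z - x)))) :=
    (Continuous.tendsto (by fun_prop) 0).mono_left nhdsWithin_le_nhds
  have h := ge_of_tendsto hlim (by
    filter_upwards [Ioc_mem_nhdsGT (zero_lt_one' ℝ)] with t ht using hineq t ht.1 ht.2)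
  have e : -b - app M (x - c) = -a := by rw [ha]; abel
  rw [e, inner_neg_left]
  linarith

lemma lowerSemicontinuous_proxObjective (hF : IsProperClosedConvex F) :
    LowerSemicontinuous (proxObjective F M b c) := by
  refine hF.closed.add' (Continuous.lowerSemicontinuous ?_) fun x => ?_
  · refine continuous_coe_real_ereal.comp ?_
    have := (continuous_quad M).comp (continuous_id.sub (continuous_const (y := c)))
    exact (continuous_const.inner continuous_id).add (continuous_const.mul this)
  · exact EReal.continuousAt_add (Or.inr (EReal.coe_ne_bot _)) (Or.inr (EReal.coe_ne_top _))

lemma exists_isMinOn_of_coercive {h : E n → EReal} (hlsc : LowerSemicontinuous h)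
    {z₀ : E n} (hz₀ : h z₀ < ⊤) {α β γ : ℝ} (hα : 0 < α)
    (hge : ∀ z, ((α * ‖z‖ ^ 2 - β * ‖z‖ - γ : ℝ) : EReal) ≤ h z) :
    ∃ x, IsMinOn h Set.univ x := by
  obtain ⟨r, hr⟩ := EReal.lt_iff_exists_real_btwn.1 hz₀
  -- Outside this ball ‖z‖ ≥ 1 and α‖z‖ ≥ |β| + |γ| + |r|, so the quadratic minorant exceeds r.
  set ρ : ℝ := max ‖z₀‖ ((|β| + |γ| + |r|) / α + 1) with hρ
  obtain ⟨x, -, hx⟩ := LowerSemicontinuousOn.exists_isMinOn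
    (s := Metric.closedBall (0 : E n) ρ) (f := h)
    ⟨z₀, by simp [hρ]⟩ (isCompact_closedBall _ _) (hlsc.lowerSemicontinuousOn _)
  refine ⟨x, fun z _ => ?_⟩
  by_cases hz : z ∈ Metric.closedBall (0 : E n) ρ
  · exact hx hz
  · have h1 : h x ≤ h z₀ := hx (by simp [hρ])
    refine (h1.trans hr.1.le).trans (le_trans ?_ (hge z))
    rw [EReal.coe_le_coe_iff]
    rw [mem_closedBall_zero_iff, not_le] at hz
    have h2 : (|β| + |γ| + |r|) / α + 1 < ‖z‖ := (le_max_right _ _).trans_lt hz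
    have h0 : 0 ≤ (|β| + |γ| + |r|) / α := by positivity
    have h3 : |β| + |γ| + |r| ≤ α * ‖z‖ := by
      have : (|β| + |γ| + |r|) / α ≤ ‖z‖ := by linarith
      rw [div_le_iff₀ hα] at this
      linarith
    have h4 : 1 ≤ ‖z‖ := by linarith
    have h5 := mul_le_mul_of_nonneg_right h3 (norm_nonneg z)
    nlinarith [le_abs_self β, le_abs_self γ, le_abs_self r, abs_nonneg γ, abs_nonneg r]

/-- A proper closed convex function with a quadratic minorant whose sum with the proximal term is
positive definite has a proximal point. -/
lemma exists_isMinOn_proxObjective (hF : IsProperClosedConvex F) (hM : M.IsSymm)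
    {T : Matrix (Fin n) (Fin n) ℝ} (hT : T.IsSymm) (hMT : (M + T).PosDef) {ξ x₀ : E n} {r : ℝ}
    (hge : ∀ z, ((r + inner ℝ ξ z + 1 / 2 * quad T (z - x₀) : ℝ) : EReal) ≤ F z) :
    ∃ x, IsMinOn (proxObjective F M b c) Set.univ x := by
  obtain ⟨z₀, hz₀⟩ := hF.exists_lt_top
  obtain ⟨a, ha⟩ := hF.exists_real hz₀
  obtain ⟨α, hα, hquad⟩ := exists_quad_ge hMT
  set ζ := ξ + b - app M c - app T x₀ with hζ
  refine exists_isMinOn_of_coercive (lowerSemicontinuous_proxObjective hF)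
    (z₀ := z₀) (α := α / 2) (β := ‖ζ‖) (γ := -(r + 1 / 2 * quad T x₀ + 1 / 2 * quad M c)) ?_
    (by positivity) fun z => ?_
  · rw [proxObjective, ha, ← EReal.coe_add]; exact EReal.coe_lt_top _
  · refine le_trans ?_ (add_le_add_left (hge z) _)
    rw [← EReal.coe_add, EReal.coe_le_coe_iff]
    have h1 := quad_add hM z (-c)
    have h2 := quad_add hT z (-x₀)
    rw [← sub_eq_add_neg, quad_neg, inner_neg_right, inner_app_symm hM] at h1
    rw [← sub_eq_add_neg, quad_neg, inner_neg_right, inner_app_symm hT] at h2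
    have h3 := hquad z
    rw [quad_add_matrix] at h3
    have h4 := neg_le_of_abs_le (abs_real_inner_le_norm ζ z)
    have h5 : (inner ℝ ζ z : ℝ) = inner ℝ ξ z + inner ℝ b z - inner ℝ (app M c) z
        - inner ℝ (app T x₀) z := by
      rw [hζ, inner_sub_left, inner_sub_left, inner_add_left]
    linarith

lemma quad_one (x : E n) : quad (1 : Matrix (Fin n) (Fin n) ℝ) x = ‖x‖ ^ 2 := by
  rw [quad, one_app, real_inner_self_eq_norm_sq]

/-- Points with a subgradient are dense in the domain, in the form of the proximal points `p` of
`w`: they have a subgradient proportional to `w - p`. -/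
lemma exists_subgradient_near (hF : IsProperClosedConvex F) {w : E n} (hw : F w < ⊤) {δ : ℝ}
    (hδ : 0 < δ) :
    ∃ (p : E n) (μ : ℝ), ‖w - p‖ ≤ δ ∧ 0 ≤ μ ∧ μ • (w - p) ∈ subdifferential F p := by
  obtain ⟨a, ha⟩ := hF.exists_real hw
  obtain ⟨ξ, r, hξ⟩ := hF.exists_affine_minorant
  set B : ℝ := max 0 (a - r - inner ℝ ξ w) with hB
  -- Minimality of p gives (μ/2)‖w - p‖² ≤ B + ‖ξ‖‖w - p‖; this μ makes that fail once ‖w - p‖ > δ.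
  set μ : ℝ := 2 * (‖ξ‖ * δ + B) / δ ^ 2 + 1 with hμ
  have hBn : 0 ≤ B := le_max_left _ _
  have hμ1 : 0 < μ := by positivity
  have hsymm : (μ • (1 : Matrix (Fin n) (Fin n) ℝ)).IsSymm := Matrix.isSymm_one.smul μ
  obtain ⟨p, hp⟩ := exists_isMinOn_proxObjective (M := μ • (1 : Matrix (Fin n) (Fin n) ℝ))
    (T := 0) (b := 0) (c := w) (ξ := ξ) (x₀ := 0) (r := r) hF hsymm Matrix.isSymm_zero
    (by rw [add_zero]; exact Matrix.PosDef.one.smul hμ1)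
    (fun z => by
      have h : quad (0 : Matrix (Fin n) (Fin n) ℝ) (z - 0) = 0 := by simp [quad, app]
      rw [h, mul_zero, add_zero, add_comm]; exact hξ z)
  have hsub := mem_subdifferential_of_isMinOn hF hsymm hp
  rw [matrix_smul_app, one_app] at hsub
  refine ⟨p, μ, ?_, hμ1.le, by convert hsub using 1; module⟩
  have h : proxObjective F (μ • (1 : Matrix (Fin n) (Fin n) ℝ)) 0 w p
      ≤ proxObjective F (μ • (1 : Matrix (Fin n) (Fin n) ℝ)) 0 w w := hp (Set.mem_univ w)
  rw [proxObjective, proxObjective, ha] at h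
  replace h := (add_le_add_left (hξ p) _).trans h
  rw [← EReal.coe_add, ← EReal.coe_add, EReal.coe_le_coe_iff, quad_smul_matrix, quad_smul_matrix,
    quad_one, quad_one, sub_self, norm_zero, inner_zero_left, inner_zero_left,
    norm_sub_rev p w] at h
  by_contra! hlt
  have h2 : (inner ℝ ξ p : ℝ) = inner ℝ ξ w - inner ℝ ξ (w - p) := by rw [inner_sub_right]; ring
  have h3 := real_inner_le_norm ξ (w - p)
  have h4 : a - r - inner ℝ ξ w ≤ B := le_max_right _ _
  have h5 : 1 / 2 * (μ * ‖w - p‖ ^ 2) ≤ B + ‖ξ‖ * ‖w - p‖ := by linarith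
  have h6 : μ * δ ^ 2 = 2 * (‖ξ‖ * δ + B) + δ ^ 2 := by rw [hμ]; field_simp
  set q := ‖w - p‖
  have h7 : 0 < δ ^ 2 := by positivity
  have h8 : δ * q ≤ q ^ 2 := by nlinarith
  have h9 : μ * δ ^ 2 * q ≤ 2 * (B + ‖ξ‖ * q) * δ := by
    have i1 := mul_le_mul_of_nonneg_left h8 (mul_nonneg hμ1.le hδ.le)
    have i2 := mul_le_mul_of_nonneg_right h5 hδ.le
    linarith
  rw [h6] at h9
  nlinarith [mul_nonneg hBn (sub_nonneg.2 hlt.le), mul_pos h7 (hδ.trans hlt)]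

/-- A strengthened subgradient inequality. -/
lemma IsMonotonicityMatrix.subgradient_le (hF : IsProperClosedConvex F)
    {S : Matrix (Fin n) (Fin n) ℝ} (hS : IsMonotonicityMatrix F S) {x ξ : E n} {r : ℝ}
    (hr : F x = r) (hξ : ξ ∈ subdifferential F x) (z : E n) :
    ((r + inner ℝ ξ (z - x) + 1 / 4 * quad S (z - x) : ℝ) : EReal) ≤ F z := by
  rcases eq_or_ne (F z) ⊤ with hz | hz
  · rw [hz]; exact le_top
  obtain ⟨s, hs⟩ := hF.exists_real (lt_top_iff_ne_top.2 hz)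
  rw [hs, EReal.coe_le_coe_iff]
  -- Chaining the subgradient inequalities x → p → z through p near the midpoint gives the constant
  -- 1/4. This is exactly enough: 1/4 S is half of the matrix S/2 that is added to M₁.
  set w := x + (1 / 2 : ℝ) • (z - x) with hw
  have hwt : F w < ⊤ := lt_of_le_of_lt
    (hF.le_combination hr.le hs.le (by norm_num) (by norm_num)) (EReal.coe_lt_top _)
  have key : ∀ k : ℕ, ∃ p, ‖w - p‖ ≤ 1 / ((k : ℝ) + 1) ∧
      r + inner ℝ ξ (z - x) + quad S (p - x) - 2 * inner ℝ ξ (w - p) ≤ s := by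
    intro k
    obtain ⟨p, μ, hp, hμ, hη⟩ := exists_subgradient_near hF hwt
      (δ := 1 / ((k : ℝ) + 1)) (by positivity)
    refine ⟨p, hp, ?_⟩
    obtain ⟨t, ht⟩ := hF.exists_real hη.1
    have h1 := hη.2 z
    have h2 := hξ.2 p
    rw [ht, hs, ← EReal.coe_add, EReal.coe_le_coe_iff] at h1
    rw [ht, hr, ← EReal.coe_add, EReal.coe_le_coe_iff] at h2
    have h3 := hS.2 p x _ _ hη hξ
    have e : z - p = (p - x) + (2 : ℝ) • (w - p) := by rw [hw]; module
    have e2 : z - x = (2 : ℝ) • (p - x) + (2 : ℝ) • (w - p) := by rw [hw]; module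
    -- The subgradient at p is a nonnegative multiple of w - p, so the error of replacing w by p has
    -- a favourable sign, however large μ becomes as p → w.
    have h4 : 0 ≤ μ * (inner ℝ (w - p) (w - p) : ℝ) := mul_nonneg hμ real_inner_self_nonneg
    rw [e] at h1
    rw [e2]
    simp only [inner_add_right, inner_smul_right, inner_smul_left, inner_sub_left (μ • (w - p)), RCLike.conj_to_real] at h1 h2 h3 ⊢
    linarith
  choose p hp hps using key
  have hlim : Tendsto p atTop (𝓝 w) := by
    rw [tendsto_iff_norm_sub_tendsto_zero]
    exact squeeze_zero (fun _ => norm_nonneg _) (fun k => by rw [norm_sub_rev]; exact hp k)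
      tendsto_one_div_add_atTop_nhds_zero_nat
  have hcont : Continuous fun p : E n =>
      r + inner ℝ ξ (z - x) + quad S (p - x) - 2 * inner ℝ ξ (w - p) := by
    have := (continuous_quad S).comp (continuous_id.sub (continuous_const (y := x)))
    exact (continuous_const.add this).sub (by fun_prop)
  have h := le_of_tendsto' ((hcont.tendsto w).comp hlim) hps
  have e : w - x = (1 / 2 : ℝ) • (z - x) := by rw [hw]; module
  rw [sub_self, inner_zero_right, e, quad_smul] at h
  linarith

lemma existsUnique_isMinOn_proxObjective (hF : IsProperClosedConvex F)
    {S : Matrix (Fin n) (Fin n) ℝ} (hS : IsMonotonicityMatrix F S) (hM : M.IsSymm)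
    (hMS : (M + (1 / 2 : ℝ) • S).PosDef) (b c : E n) :
    ∃! x, IsMinOn (proxObjective F M b c) Set.univ x := by
  have hSs := isSymm_of_posSemidef hS.1
  refine existsUnique_of_exists_of_unique ?_ fun x x' hx hx' => ?_
  · obtain ⟨w, hw⟩ := hF.exists_lt_top
    obtain ⟨p, μ, -, -, hp⟩ := exists_subgradient_near hF hw one_pos
    obtain ⟨r, hr⟩ := hF.exists_real hp.1
    refine exists_isMinOn_proxObjective (T := (1 / 2 : ℝ) • S) (x₀ := p) (ξ := μ • (w - p))
      (r := r - inner ℝ (μ • (w - p)) p) hF hM (hSs.smul _) hMS fun z => ?_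
    have h := hS.subgradient_le hF hr hp z
    rw [inner_sub_right] at h
    rw [quad_smul_matrix]
    convert h using 2
    ring
  · have h := hS.2 x x' _ _ (mem_subdifferential_of_isMinOn hF hM hx)
      (mem_subdifferential_of_isMinOn hF hM hx')
    -- The two subgradients differ by -M(x - x'), so monotonicity gives ‖x - x'‖²_{M+S} ≤ 0.
    have e : (-b - app M (x - c)) - (-b - app M (x' - c)) = -app M (x - x') := by
      simp only [app_sub]; abel
    rw [e, inner_neg_left, ← quad_eq] at h
    obtain ⟨α, hα, hquad⟩ := exists_quad_ge hMS
    have h1 := hquad (x - x')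
    rw [quad_add_matrix, quad_smul_matrix] at h1
    have h2 := quad_nonneg hS.1 (x - x')
    have h3 : ‖x - x'‖ ^ 2 ≤ 0 := by
      by_contra! h4
      have := mul_pos hα h4
      linarith
    have h4 : ‖x - x'‖ = 0 := by
      have := sq_nonneg ‖x - x'‖
      exact pow_eq_zero_iff two_ne_zero |>.1 (le_antisymm h3 this)
    exact sub_eq_zero.1 (norm_eq_zero.1 h4)

lemma isMonotonicityMatrix_zero (hF : IsProperClosedConvex F) : IsMonotonicityMatrix F 0 := by
  refine ⟨Matrix.PosSemidef.zero, fun x₁ x₂ ξ₁ ξ₂ h₁ h₂ => ?_⟩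
  obtain ⟨a, ha⟩ := hF.exists_real h₁.1
  obtain ⟨b, hb⟩ := hF.exists_real h₂.1
  have h3 := h₁.2 x₂
  have h4 := h₂.2 x₁
  rw [ha, hb, ← EReal.coe_add, EReal.coe_le_coe_iff] at h3 h4
  have h : quad (0 : Matrix (Fin n) (Fin n) ℝ) (x₁ - x₂) = 0 := by simp [quad, app]
  rw [h]
  simp only [inner_sub_left, inner_sub_right] at h3 h4 ⊢
  linarith

end ConvexAnalysis

/-! ### The Lyapunov function and its decrease. -/

/-- The Lyapunov function of the iteration, in terms of the errors `u = xᵏ⁺¹ - x⋆`, `v = yᵏ - y⋆`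
and the difference `d = xᵏ⁺¹ - xᵏ`. -/
noncomputable def lyapunov {m n : ℕ} (K : Matrix (Fin m) (Fin n) ℝ)
    (S M₁ : Matrix (Fin n) (Fin n) ℝ) (M₂ : Matrix (Fin m) (Fin m) ℝ) (u : E n) (v : E m)
    (d : E n) : ℝ :=
  1 / 2 * quad (M₁ + S) u + 1 / 2 * quad M₂ (v + app M₂⁻¹ (app K d)) + 1 / 8 * quad S d
    + 1 / 4 * (quad (M₁ + (1 / 2 : ℝ) • S) d - 1 / 2 * inner ℝ (app K d) (app M₂⁻¹ (app K d)))

/-- The three monotonicity inequalities `h1`, `h2`, `h4` enter with weights 1, 1, 1/2. The first two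
telescope the distance terms and leave ½‖d'‖_P² + ½‖e - p‖² - ½q(d'). Completing the square in e
produces ⟨K d', e⟩, which `h4` controls. -/
lemma lyapunov_decrease {m n : ℕ} {K : Matrix (Fin m) (Fin n) ℝ}
    {S M₁ : Matrix (Fin n) (Fin n) ℝ} {M₂ : Matrix (Fin m) (Fin m) ℝ}
    (hS : S.PosSemidef) (hM : StepCondition K S M₁ M₂) {κ : ℝ} (hκ : κ < 4 / 3)
    (hb : ∀ d : E n,
      inner ℝ (app K d) (app M₂⁻¹ (app K d)) ≤ κ * quad (M₁ + (1 / 2 : ℝ) • S) d)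
    {u d d' : E n} {v e : E m}
    (h1 : quad S (u + d') ≤ -inner ℝ (app K (u + d')) (v + e) - inner ℝ (app M₁ d') (u + d'))
    (h2 : 0 ≤ inner ℝ (app K (u + d)) (v + e) - inner ℝ (app M₂ e) (v + e))
    (h4 : quad S d' ≤ -inner ℝ (app K d') e - inner ℝ (app M₁ (d' - d)) d') :
    lyapunov K S M₁ M₂ (u + d') (v + e) d'
      + (1 / 2 * (1 - 3 / 4 * κ) * quad (M₁ + (1 / 2 : ℝ) • S) d'
        + 1 / 2 * quad M₂ (e - app M₂⁻¹ (app K d) + (1 / 2 : ℝ) • app M₂⁻¹ (app K d')))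
      ≤ lyapunov K S M₁ M₂ u v d := by
  have hSs := isSymm_of_posSemidef hS
  have hq : ∀ x : E n, 0 ≤ inner ℝ (app K x) (app M₂⁻¹ (app K x)) := fun x => by
    have h := quad_nonneg hM.posDef₂.posSemidef (app M₂⁻¹ (app K x))
    rwa [quad_eq, app_inv_app hM.posDef₂] at h
  have a1 := quad_nonneg hS (u + (u + d'))
  have a2 := quad_nonneg hS (d + d')
  have a3 := hq (d + d')
  have hm : 0 ≤ quad (M₁ + (1 / 2 : ℝ) • S) (d - d') := quad_nonneg hM.posDef₁.posSemidef _
  -- The first use of 4/3: with weight 3/16 it turns ¼‖d - d'‖_P² into a bound on the cross term ⟨p,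
  -- p'⟩. The second is `a5`, which leaves the factor 1 - 3κ/4 > 0.
  have a4 : inner ℝ (app K (d - d')) (app M₂⁻¹ (app K (d - d')))
      ≤ 4 / 3 * quad (M₁ + (1 / 2 : ℝ) • S) (d - d') := (hb _).trans (by gcongr)
  have a5 := hb d'
  set p := app M₂⁻¹ (app K d) with hp
  set p' := app M₂⁻¹ (app K d') with hp'
  have ep : app M₂ p = app K d := app_inv_app hM.posDef₂ _
  have ep' : app M₂ p' = app K d' := app_inv_app hM.posDef₂ _
  have sS := inner_app_symm hSs
  have s1 := inner_app_symm hM.symm₁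
  have s2 := inner_app_symm hM.symm₂
  have c1 := s2 p v
  have c2 := s2 p e
  have c3 := s2 p' v
  have c4 := s2 p' e
  have c5 := s2 p p'
  rw [ep] at c1 c2 c5
  rw [ep'] at c3 c4 c5
  simp only [lyapunov, ← hp, ← hp', quad_eq, app_add, app_sub, app_smul, matrix_add_app,
    matrix_smul_app, inner_add_left, inner_add_right, inner_sub_left, inner_sub_right,
    inner_smul_left, inner_smul_right, ep, ep', RCLike.conj_to_real] at *
  -- The nonnegative forms `a1`, `a2`, `a3` enter with weights 1/4, 1/8, 1/16, and `a4`, `a5` with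
  -- 3/16, 3/8.
  linarith [sS u d, sS u d', sS d d', s1 u d, s1 u d', s1 d d', s2 e v]

/-! ### The iterates and their KKT residuals. -/

section Iteration

variable {m n : ℕ} {f : E n → EReal} {g : E m → EReal} {K : Matrix (Fin m) (Fin n) ℝ}
  {S M₁ : Matrix (Fin n) (Fin n) ℝ} {M₂ : Matrix (Fin m) (Fin m) ℝ} {x₀ : E n} {y₀ : E m}
  {z : ℕ → E n × E m}

lemma inner_transpose_app (K : Matrix (Fin m) (Fin n) ℝ) (x : E n) (y : E m) :
    inner ℝ (app K.transpose y) x = inner ℝ (app K x) y := by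
  rw [inner_app_left K, real_inner_comm]

lemma isIterates_iff : IsIterates f g K M₁ M₂ x₀ y₀ z ↔ z 0 = (x₀, y₀) ∧
    (∀ k, IsMinOn (proxObjective f M₁ (app K.transpose (z k).2) (z k).1) Set.univ (z (k + 1)).1) ∧
    ∀ k, IsMinOn (proxObjective (conjugate g) M₂
      (-app K ((2 : ℝ) • (z (k + 1)).1 - (z k).1)) (z k).2) Set.univ (z (k + 1)).2 := by
  have h1 : ∀ (x : E n) (y : E m), proxObjective f M₁ (app K.transpose y) x = fun w => f w +
      ((inner ℝ (app K w) y + (1 / 2) * quad M₁ (w - x) : ℝ) : EReal) := fun x y => by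
    funext w; rw [proxObjective, inner_transpose_app]
  have h2 : ∀ b y : E m, proxObjective (conjugate g) M₂ (-b) y = fun w => conjugate g w +
      ((-inner ℝ b w + (1 / 2) * quad M₂ (w - y) : ℝ) : EReal) := fun b y => by
    funext w; rw [proxObjective, inner_neg_left]
  simp only [h1, h2]
  exact ⟨fun h => ⟨h.init, h.step_x, h.step_y⟩, fun h => ⟨h.1, h.2.1, h.2.2⟩⟩

theorem existsUnique_isIterates (hf : IsProperClosedConvex f) (hg : IsProperClosedConvex g)
    (hS : IsMonotonicityMatrix f S) (hM : StepCondition K S M₁ M₂) (x₀ : E n) (y₀ : E m) :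
    ∃! z : ℕ → E n × E m, IsIterates f g K M₁ M₂ x₀ y₀ z := by
  have hX := existsUnique_isMinOn_proxObjective hf hS hM.symm₁ hM.posDef₁
  have hg' := isProperClosedConvex_conjugate hg
  have hY := existsUnique_isMinOn_proxObjective hg' (isMonotonicityMatrix_zero hg') hM.symm₂
    (by rw [smul_zero, add_zero]; exact hM.posDef₂)
  choose X hX hXu using hX
  choose Y hY hYu using hY
  obtain ⟨w, hw0, hw⟩ : ∃ w : ℕ → E n × E m, w 0 = (x₀, y₀) ∧ ∀ k, w (k + 1) =
      (X (app K.transpose (w k).2) (w k).1, Y (-app K ((2 : ℝ) •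
        X (app K.transpose (w k).2) (w k).1 - (w k).1)) (w k).2) :=
    ⟨fun k => (fun p : E n × E m => (X (app K.transpose p.2) p.1, Y (-app K ((2 : ℝ) •
      X (app K.transpose p.2) p.1 - p.1)) p.2))^[k] (x₀, y₀), rfl,
      fun k => Function.iterate_succ_apply' _ _ _⟩
  refine ⟨w, isIterates_iff.2 ⟨hw0, fun k => ?_, fun k => ?_⟩, fun z hz => ?_⟩
  · rw [hw]; exact hX _ _
  · rw [hw]; exact hY _ _
  obtain ⟨h0, h1, h2⟩ := isIterates_iff.1 hz
  funext k
  induction k with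
  | zero => rw [h0, hw0]
  | succ k ih =>
    have e1 := hXu _ _ _ (h1 k)
    have e2 := hYu _ _ _ (h2 k)
    rw [e1] at e2
    rw [← Prod.eta (z (k + 1)), e1, e2, ih, hw]

lemma exists_kkt_point (hf : IsProperClosedConvex f) (hg : IsProperClosedConvex g)
    (h : HasSaddlePoint f g K) :
    ∃ (x : E n) (y : E m), -app K.transpose y ∈ subdifferential f x ∧
      app K x ∈ subdifferential (conjugate g) y := by
  obtain ⟨x, y, hxy⟩ := h
  have hg' := isProperClosedConvex_conjugate hg
  replace hxy : ∀ x' y', lagrangian f g K x y' ≤ lagrangian f g K x' y :=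
    fun x' y' => hxy x' (Set.mem_univ _) y' (Set.mem_univ _)
  simp only [lagrangian] at hxy
  obtain ⟨x₁, hx₁⟩ := hf.exists_lt_top
  obtain ⟨a₁, ha₁⟩ := hf.exists_real hx₁
  obtain ⟨y₁, hy₁⟩ := hg'.exists_lt_top
  obtain ⟨b₁, hb₁⟩ := hg'.exists_real hy₁
  have h₁ := hxy x₁ y₁
  rw [ha₁, hb₁] at h₁
  -- Were it ⊤, the Lagrangian at (x₁, y) would be ⊥, forcing the value at (x, y₁) to be ⊥ although
  -- no term there allows it.
  have hy : conjugate g y < ⊤ := by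
    rw [lt_top_iff_ne_top]
    intro hy
    rw [hy, EReal.sub_top, le_bot_iff, sub_eq_add_neg, ← EReal.coe_neg, EReal.add_eq_bot_iff,
      EReal.add_eq_bot_iff] at h₁
    rcases h₁ with (h₁ | h₁) | h₁
    · exact hf.ne_bot _ h₁
    · exact EReal.coe_ne_bot _ h₁
    · exact EReal.coe_ne_bot _ h₁
  obtain ⟨b, hb⟩ := hg'.exists_real hy
  have hx : f x < ⊤ := by
    rw [lt_top_iff_ne_top]
    intro hx
    rw [hx, hb, EReal.top_add_coe, EReal.top_sub_coe, top_le_iff, ← EReal.coe_add,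
      ← EReal.coe_sub] at h₁
    exact EReal.coe_ne_top _ h₁
  obtain ⟨a, ha⟩ := hf.exists_real hx
  refine ⟨x, y, ⟨hx, fun w => ?_⟩, ⟨hy, fun w => ?_⟩⟩
  · rcases eq_or_ne (f w) ⊤ with hw | hw
    · rw [hw]; exact le_top
    obtain ⟨c, hc⟩ := hf.exists_real (lt_top_iff_ne_top.2 hw)
    have h := hxy w y
    rw [ha, hb, hc] at h
    rw [ha, hc]
    norm_cast at h ⊢
    rw [inner_neg_left, inner_transpose_app, app_sub, inner_sub_left]
    linarith
  · rcases eq_or_ne (conjugate g w) ⊤ with hw | hw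
    · rw [hw]; exact le_top
    obtain ⟨c, hc⟩ := hg'.exists_real (lt_top_iff_ne_top.2 hw)
    have h := hxy x w
    rw [ha, hb, hc] at h
    rw [hb, hc]
    norm_cast at h ⊢
    rw [inner_sub_right]
    linarith

lemma IsIterates.subgradient_x (hf : IsProperClosedConvex f) (hM : StepCondition K S M₁ M₂)
    (hz : IsIterates f g K M₁ M₂ x₀ y₀ z) (k : ℕ) :
    -app K.transpose (z k).2 - app M₁ ((z (k + 1)).1 - (z k).1) ∈
      subdifferential f (z (k + 1)).1 :=
  mem_subdifferential_of_isMinOn hf hM.symm₁ ((isIterates_iff.1 hz).2.1 k)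

lemma IsIterates.subgradient_y (hg : IsProperClosedConvex g) (hM : StepCondition K S M₁ M₂)
    (hz : IsIterates f g K M₁ M₂ x₀ y₀ z) (k : ℕ) :
    app K ((2 : ℝ) • (z (k + 1)).1 - (z k).1) - app M₂ ((z (k + 1)).2 - (z k).2) ∈
      subdifferential (conjugate g) (z (k + 1)).2 := by
  have h := mem_subdifferential_of_isMinOn (isProperClosedConvex_conjugate hg) hM.symm₂
    ((isIterates_iff.1 hz).2.2 k)
  rwa [neg_neg] at h

lemma IsIterates.lyapunov_decrease (hf : IsProperClosedConvex f) (hg : IsProperClosedConvex g)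
    (hS : IsMonotonicityMatrix f S) (hM : StepCondition K S M₁ M₂)
    (hz : IsIterates f g K M₁ M₂ x₀ y₀ z) {κ : ℝ} (hκ : κ < 4 / 3)
    (hb : ∀ d : E n,
      inner ℝ (app K d) (app M₂⁻¹ (app K d)) ≤ κ * quad (M₁ + (1 / 2 : ℝ) • S) d)
    {x : E n} {y : E m} (hx : -app K.transpose y ∈ subdifferential f x)
    (hy : app K x ∈ subdifferential (conjugate g) y) (k : ℕ) :
    lyapunov K S M₁ M₂ ((z (k + 2)).1 - x) ((z (k + 1)).2 - y) ((z (k + 2)).1 - (z (k + 1)).1)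
      + (1 / 2 * (1 - 3 / 4 * κ) * quad (M₁ + (1 / 2 : ℝ) • S) ((z (k + 2)).1 - (z (k + 1)).1)
        + 1 / 2 * quad M₂ ((z (k + 1)).2 - (z k).2
            - app M₂⁻¹ (app K ((z (k + 1)).1 - (z k).1))
            + (1 / 2 : ℝ) • app M₂⁻¹ (app K ((z (k + 2)).1 - (z (k + 1)).1))))
      ≤ lyapunov K S M₁ M₂ ((z (k + 1)).1 - x) ((z k).2 - y) ((z (k + 1)).1 - (z k).1) := by
  have e1 : (z (k + 2)).1 - x = ((z (k + 1)).1 - x) + ((z (k + 2)).1 - (z (k + 1)).1) := by abel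
  have e2 : (z (k + 1)).2 - y = ((z k).2 - y) + ((z (k + 1)).2 - (z k).2) := by abel
  have i1 := hz.subgradient_x hf hM k
  have i2 := hz.subgradient_x hf hM (k + 1)
  have i3 := hz.subgradient_y hg hM k
  have h1 := hS.2 _ _ _ _ i2 hx
  have h2 := (isMonotonicityMatrix_zero (isProperClosedConvex_conjugate hg)).2 _ _ _ _ i3 hy
  have h4 := hS.2 _ _ _ _ i2 i1
  have h0 : quad (0 : Matrix (Fin m) (Fin m) ℝ) ((z (k + 1)).2 - y) = 0 := by simp [quad, app]
  rw [h0] at h2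
  rw [e1, e2]
  refine PrePDHG.lyapunov_decrease hS.1 hM hκ hb ?_ ?_ ?_
  · rw [← e1, ← e2]
    refine h1.trans_eq ?_
    rw [← inner_transpose_app, ← inner_neg_left, ← inner_sub_left]
    congr 1
    simp only [app_sub]
    abel
  · rw [← e2, ← inner_sub_left]
    refine h2.trans_eq ?_
    congr 1
    simp only [app_sub, app_add, app_smul]
    module
  · refine h4.trans_eq ?_
    rw [← inner_transpose_app, ← inner_neg_left, ← inner_sub_left]
    congr 1
    simp only [app_sub]
    abel

lemma lyapunov_nonneg (hS : S.PosSemidef) (hM : StepCondition K S M₁ M₂) {κ : ℝ} (hκ : κ < 4 / 3)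
    (hb : ∀ d : E n,
      inner ℝ (app K d) (app M₂⁻¹ (app K d)) ≤ κ * quad (M₁ + (1 / 2 : ℝ) • S) d)
    (u : E n) (v : E m) (d : E n) : 0 ≤ lyapunov K S M₁ M₂ u v d := by
  have h1 := quad_nonneg hM.posDef₁.posSemidef u
  have h2 := quad_nonneg hM.posDef₁.posSemidef d
  have h3 := quad_nonneg hS u
  have h4 := quad_nonneg hS d
  have h5 := quad_nonneg hM.posDef₂.posSemidef (v + app M₂⁻¹ (app K d))
  have h6 := hb d
  have h7 := mul_le_mul_of_nonneg_right hκ.le h2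
  rw [quad_add_matrix, quad_smul_matrix] at h1
  rw [lyapunov, quad_add_matrix M₁ S]
  linarith

/-- The subgradients given by the optimality conditions of the two steps are tested in the residual.
-/
lemma IsIterates.kktResidual_le (hf : IsProperClosedConvex f) (hg : IsProperClosedConvex g)
    (hM : StepCondition K S M₁ M₂) (hz : IsIterates f g K M₁ M₂ x₀ y₀ z) (k : ℕ) :
    kktResidual f g K (z (k + 1)).1 (z (k + 1)).2 ≤ ENNReal.ofReal (max
      ‖app K.transpose ((z (k + 1)).2 - (z k).2) - app M₁ ((z (k + 1)).1 - (z k).1)‖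
      ‖app K ((z (k + 1)).1 - (z k).1) - app M₂ ((z (k + 1)).2 - (z k).2)‖) := by
  rw [ENNReal.ofReal_max, ofReal_norm, ofReal_norm]
  refine max_le_max ?_ ?_
  · refine (Metric.infEDist_le_edist_of_mem (Set.mem_image_of_mem _
      (hz.subgradient_x hf hM k))).trans_eq ?_
    rw [edist_comm, edist_zero_right]
    congr 1
    simp only [app_sub]
    abel
  · refine (Metric.infEDist_le_edist_of_mem (Set.mem_image_of_mem _
      (hz.subgradient_y hg hM k))).trans_eq ?_
    rw [edist_comm, edist_zero_right]
    congr 1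
    simp only [app_sub, app_smul]
    module

open scoped Matrix.Norms.L2Operator in
lemma exists_norm_app_le {k l : ℕ} (A : Matrix (Fin k) (Fin l) ℝ) :
    ∃ L : ℝ, 0 ≤ L ∧ ∀ x, ‖app A x‖ ≤ L * ‖x‖ :=
  ⟨‖A‖, norm_nonneg _, norm_app_le A⟩

/-- The residual of the iterates is square summable. -/
lemma IsIterates.exists_residual_bound (hf : IsProperClosedConvex f)
    (hg : IsProperClosedConvex g) (hsaddle : HasSaddlePoint f g K)
    (hS : IsMonotonicityMatrix f S) (hM : StepCondition K S M₁ M₂)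
    (hz : IsIterates f g K M₁ M₂ x₀ y₀ z) :
    ∃ (ρ : ℕ → ℝ) (C : ℝ),
      (∀ k, kktResidual f g K (z (k + 1)).1 (z (k + 1)).2 ≤ ENNReal.ofReal (ρ k)) ∧
      ∀ N, ∑ k ∈ Finset.range N, ρ k ^ 2 ≤ C := by
  obtain ⟨κ, hκ, hb⟩ := hM.exists_bound
  obtain ⟨x, y, hx, hy⟩ := exists_kkt_point hf hg hsaddle
  obtain ⟨α₁, hα₁, hq₁⟩ := exists_quad_ge hM.posDef₁
  obtain ⟨α₂, hα₂, hq₂⟩ := exists_quad_ge hM.posDef₂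
  obtain ⟨L₁, hL₁, hl₁⟩ := exists_norm_app_le K.transpose
  obtain ⟨L₂, hL₂, hl₂⟩ := exists_norm_app_le M₁
  obtain ⟨L₃, hL₃, hl₃⟩ := exists_norm_app_le K
  obtain ⟨L₄, hL₄, hl₄⟩ := exists_norm_app_le M₂
  obtain ⟨L₅, hL₅, hl₅⟩ := exists_norm_app_le M₂⁻¹
  set d : ℕ → E n := fun k => (z (k + 1)).1 - (z k).1 with hd
  set e : ℕ → E m := fun k => (z (k + 1)).2 - (z k).2 with he
  set p : ℕ → E m := fun k => app M₂⁻¹ (app K (d k)) with hp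
  set s : ℕ → E m := fun k => e k - p k + (1 / 2 : ℝ) • p (k + 1) with hs
  set Φ : ℕ → ℝ := fun k => lyapunov K S M₁ M₂ ((z (k + 1)).1 - x) ((z k).2 - y) (d k) with hΦ
  have hdec : ∀ k, Φ (k + 1) + (1 / 2 * (1 - 3 / 4 * κ) * quad (M₁ + (1 / 2 : ℝ) • S) (d (k + 1))
      + 1 / 2 * quad M₂ (s k)) ≤ Φ k := fun k =>
    hz.lyapunov_decrease hf hg hS hM hκ hb hx hy k
  have hΦ0 : ∀ k, 0 ≤ Φ k := fun k => lyapunov_nonneg hS.1 hM hκ hb _ _ _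
  set c : ℝ := min (1 / 2 * (1 - 3 / 4 * κ) * α₁) (1 / 2 * α₂) with hc
  have hκ' : 0 < 1 - 3 / 4 * κ := by linarith
  have hcpos : 0 < c := lt_min (by positivity) (by positivity)
  have hstep : ∀ k, c * (‖d (k + 1)‖ ^ 2 + ‖s k‖ ^ 2) ≤ Φ k - Φ (k + 1) := by
    intro k
    have h1 : c * ‖d (k + 1)‖ ^ 2 ≤ 1 / 2 * (1 - 3 / 4 * κ) * α₁ * ‖d (k + 1)‖ ^ 2 := by
      gcongr; exact min_le_left _ _
    have h2 : c * ‖s k‖ ^ 2 ≤ 1 / 2 * α₂ * ‖s k‖ ^ 2 := by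
      gcongr; exact min_le_right _ _
    have h3 := mul_le_mul_of_nonneg_left (hq₁ (d (k + 1)))
      (show 0 ≤ 1 / 2 * (1 - 3 / 4 * κ) by positivity)
    linarith [hdec k, hq₂ (s k)]
  set L : ℝ := L₁ + L₂ + L₃ + L₄ with hL
  set P : ℝ := 1 + L₅ * L₃ with hP
  have hPL : 0 ≤ L₅ * L₃ := mul_nonneg hL₅ hL₃
  have hpn : ∀ k, ‖p k‖ ≤ L₅ * L₃ * ‖d k‖ := fun k => by
    refine (hl₅ _).trans ?_
    rw [mul_assoc]
    exact mul_le_mul_of_nonneg_left (hl₃ _) hL₅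
  have hen : ∀ k, ‖e k‖ ≤ ‖s k‖ + L₅ * L₃ * ‖d k‖ + L₅ * L₃ * ‖d (k + 1)‖ := fun k => by
    have h1 : e k = s k + p k - (1 / 2 : ℝ) • p (k + 1) := by simp only [hs]; abel
    have h2 : ‖(1 / 2 : ℝ) • p (k + 1)‖ ≤ L₅ * L₃ * ‖d (k + 1)‖ := by
      rw [norm_smul]
      norm_num
      linarith [hpn (k + 1), norm_nonneg (p (k + 1))]
    rw [h1]
    refine (norm_sub_le _ _).trans (add_le_add ((norm_add_le _ _).trans ?_) h2)
    gcongr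
    exact hpn k
  set ρ : ℕ → ℝ := fun k => L * (P * (‖d k‖ + ‖d (k + 1)‖ + ‖s k‖)) with hρ
  have hde : ∀ k, ‖d k‖ + ‖e k‖ ≤ P * (‖d k‖ + ‖d (k + 1)‖ + ‖s k‖) := fun k => by
    have h1 := hen k
    have h2 := mul_nonneg hPL (norm_nonneg (s k))
    have h3 := norm_nonneg (d (k + 1))
    rw [hP]
    linarith
  have hres : ∀ k, max ‖app K.transpose (e k) - app M₁ (d k)‖ ‖app K (d k) - app M₂ (e k)‖
      ≤ ρ k := fun k => by
    have hLp : 0 ≤ L := by positivity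
    refine le_trans ?_ (mul_le_mul_of_nonneg_left (hde k) hLp)
    have n1 := norm_nonneg (d k)
    have n2 := norm_nonneg (e k)
    have := mul_nonneg hL₁ n1
    have := mul_nonneg hL₂ n1
    have := mul_nonneg hL₃ n1
    have := mul_nonneg hL₄ n1
    have := mul_nonneg hL₁ n2
    have := mul_nonneg hL₂ n2
    have := mul_nonneg hL₃ n2
    have := mul_nonneg hL₄ n2
    refine max_le ((norm_sub_le _ _).trans ?_) ((norm_sub_le _ _).trans ?_)
    · linarith [hl₁ (e k), hl₂ (d k)]
    · linarith [hl₃ (d k), hl₄ (e k)]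
  set A : ℝ := 3 * (L * P) ^ 2 with hA
  have hA0 : 0 ≤ A := by positivity
  -- The decrease of Φ controls ‖d (k+1)‖ but not ‖d k‖. Adding A‖d k‖² to the potential shifts the
  -- index, and 2A/c leaves enough to pay for both.
  set W : ℕ → ℝ := fun k => A * ‖d k‖ ^ 2 + 2 * A / c * Φ k with hW
  have hρW : ∀ k, ρ k ^ 2 ≤ W k - W (k + 1) := fun k => by
    have h1 : ρ k ^ 2 ≤ A * (‖d k‖ ^ 2 + ‖d (k + 1)‖ ^ 2 + ‖s k‖ ^ 2) := by
      have : (‖d k‖ + ‖d (k + 1)‖ + ‖s k‖) ^ 2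
          ≤ 3 * (‖d k‖ ^ 2 + ‖d (k + 1)‖ ^ 2 + ‖s k‖ ^ 2) := by
        linarith [sq_nonneg (‖d k‖ - ‖d (k + 1)‖), sq_nonneg (‖d k‖ - ‖s k‖),
          sq_nonneg (‖d (k + 1)‖ - ‖s k‖)]
      have h := mul_le_mul_of_nonneg_left this (sq_nonneg (L * P))
      calc ρ k ^ 2 = (L * P) ^ 2 * (‖d k‖ + ‖d (k + 1)‖ + ‖s k‖) ^ 2 := by rw [hρ]; ring
        _ ≤ _ := h
        _ = _ := by rw [hA]; ring
    have h2 : 2 * A * (‖d (k + 1)‖ ^ 2 + ‖s k‖ ^ 2) ≤ 2 * A / c * (Φ k - Φ (k + 1)) := by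
      have h := mul_le_mul_of_nonneg_left (hstep k) (show 0 ≤ 2 * A / c by positivity)
      rwa [← mul_assoc, div_mul_cancel₀ _ hcpos.ne'] at h
    have h3 := mul_nonneg hA0 (sq_nonneg ‖s k‖)
    simp only [hW]
    linarith
  refine ⟨ρ, W 0, fun k => (hz.kktResidual_le hf hg hM k).trans
    (ENNReal.ofReal_le_ofReal (hres k)), fun N => ?_⟩
  have hWN : 0 ≤ W N := by
    have := hΦ0 N
    simp only [hW]
    positivity
  refine (Finset.sum_le_sum fun k _ => hρW k).trans ?_
  rw [Finset.sum_range_sub']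
  linarith

end Iteration

/-! ### From square summability to the iteration count. -/

lemma exists_isLeast_of_sum_sq_le {R : ℕ → ENNReal} {ρ : ℕ → ℝ} {C : ℝ}
    (hR : ∀ k, R (k + 1) ≤ ENNReal.ofReal (ρ k))
    (hsum : ∀ N, ∑ k ∈ Finset.range N, ρ k ^ 2 ≤ C) {ε : ℝ} (hε : 0 < ε) :
    ∃ N : ℕ, IsLeast {k : ℕ | 1 ≤ k ∧ R k ≤ ENNReal.ofReal ε} N ∧
      (N : ℝ) ≤ max 1 (2 * C / ε ^ 2) := by
  have hbound : ∀ N : ℕ, (∀ k < N, ¬ R (k + 1) ≤ ENNReal.ofReal ε) → N * ε ^ 2 ≤ C := by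
    intro N hN
    refine le_trans ?_ (hsum N)
    have h : ∀ k ∈ Finset.range N, ε ^ 2 ≤ ρ k ^ 2 := fun k hk => by
      refine pow_le_pow_left₀ hε.le ?_ 2
      by_contra! hlt
      exact hN k (Finset.mem_range.1 hk) ((hR k).trans (ENNReal.ofReal_le_ofReal hlt.le))
    simpa using Finset.card_nsmul_le_sum _ _ _ h
  have hne : ∃ k, R (k + 1) ≤ ENNReal.ofReal ε := by
    by_contra! hcon
    obtain ⟨N, hN⟩ := exists_nat_gt (C / ε ^ 2)
    rw [div_lt_iff₀ (by positivity)] at hN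
    exact absurd (hbound N fun k _ => not_le.2 (hcon k)) (not_le.2 hN)
  classical
  refine ⟨Nat.find hne + 1, ⟨⟨by omega, Nat.find_spec hne⟩, ?_⟩, ?_⟩
  · rintro k ⟨hk, hRk⟩
    obtain ⟨j, rfl⟩ := Nat.exists_eq_add_of_le' hk
    exact Nat.succ_le_succ (Nat.find_min' hne hRk)
  · have h := hbound (Nat.find hne) fun k hk => Nat.find_min hne hk
    rcases Nat.eq_zero_or_pos (Nat.find hne) with h0 | h0
    · rw [h0]; simp
    -- With j ≥ 1 failed tests the stopping index is j + 1 ≤ 2j, which is why the constant is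
    -- doubled.
    · refine le_trans ?_ (le_max_right _ _)
      rw [le_div_iff₀ (by positivity)]
      have h1 : (1 : ℝ) ≤ Nat.find hne := by exact_mod_cast h0
      have h2 := mul_le_mul_of_nonneg_right h1 (sq_nonneg ε)
      push_cast
      linarith

end PrePDHG

theorem mainTheorem7 {m n : ℕ}
    (f : PrePDHG.E n → EReal) (g : PrePDHG.E m → EReal) (K : Matrix (Fin m) (Fin n) ℝ)
    (hf : PrePDHG.IsProperClosedConvex f) (hg : PrePDHG.IsProperClosedConvex g)
    (hsaddle : PrePDHG.HasSaddlePoint f g K)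
    (S : Matrix (Fin n) (Fin n) ℝ) (hS : PrePDHG.IsMonotonicityMatrix f S)
    (M₁ : Matrix (Fin n) (Fin n) ℝ) (M₂ : Matrix (Fin m) (Fin m) ℝ)
    (hM : PrePDHG.StepCondition K S M₁ M₂)
    (x₀ : PrePDHG.E n) (y₀ : PrePDHG.E m) :
    (∃! z : ℕ → PrePDHG.E n × PrePDHG.E m, PrePDHG.IsIterates f g K M₁ M₂ x₀ y₀ z) ∧
    ∃ C : ℝ, ∀ z : ℕ → PrePDHG.E n × PrePDHG.E m,
      PrePDHG.IsIterates f g K M₁ M₂ x₀ y₀ z →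
      ∀ ε : ℝ, 0 < ε →
        ∃ N : ℕ, PrePDHG.StopsAfter f g K z ε N ∧ (N : ℝ) ≤ max 1 (C / ε ^ 2) := by
  have hunique := PrePDHG.existsUnique_isIterates hf hg hS hM x₀ y₀
  refine ⟨hunique, ?_⟩
  obtain ⟨z, hz, -⟩ := id hunique
  obtain ⟨ρ, C, hρ, hC⟩ := hz.exists_residual_bound hf hg hsaddle hS hM
  refine ⟨2 * C, fun z' hz' ε hε => ?_⟩
  obtain rfl := hunique.unique hz hz'
  exact PrePDHG.exists_isLeast_of_sum_sq_le
    (R := fun k => PrePDHG.kktResidual f g K (z k).1 (z k).2) hρ hC hε
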